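/- A \emph{tree order} is a partially ordered set $(E,\le)$ such that for every $e\in E$ the set $\{x\in E\mid x\le e\}$ is finite and totally ordered by $\le$. For such $E$ let $i_E:E\to E\sqcup\{\ast\}$ send $e$ to the greatest element strictly below $e$ if $e$ is not minimal, and to $\ast$ if $e$ is minimal. A monotone map $f:E\to F$ between tree orders is \emph{strict} if $i_F\circ f=f_\ast\circ i_E$, where $f_\ast:E\sqcup\{\ast\}\to F\sqcup\{\ast\}$ extends $f$ by $\ast\mapsto\ast$. Let $\mathbf{Tree}$ be the category of tree orders and strict maps, $|-|:\mathbf{Tree}\to\mathbf{Set}$ its forgetful functor, and $(-)^\star:\mathbf{Set}\to\mathbf{Set}$ the functor sending a set $V$ to the set $V^\star$ of finite words in $V$ and a function $g$ to the function $g^\star$ applying $g$ letterwise. A \emph{hierarchical hypergraph} is a triple $(E,V,e)$ of a tree order $E$ (of hyperedges), a set $V$ (of nodes) and a function $e:E\to V^\star$. A morphism $(E,V,e)\to(E',V',e')$ is a pair $(f,g)$ of a strict map $f:E\to E'$ and a function $g:V\to V'$ such that $e'\circ f=g^\star\circ e$. With componentwise composition these form a category $\mathbf{HHGraph}$. A category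 is \emph{adhesive} if it has pullbacks, it has pushouts along monomorphisms, and pushouts along monomorphisms are Van Kampen squares: for every commutative cube with such a pushout as bottom face and pullbacks as back faces, the top face is a pushout if and only if the front faces are pullbacks. \textbf{Theorem.} (1) The functor from $\mathbf{HHGraph}$ to the comma category $(|-|\downarrow(-)^\star)$ which sends $(E,V,e)$ to the object given by $E$, $V$ and $e:|E|\to V^\star$, and which is the identity on pairs $(f,g)$, is an isomorphism of categories. (2) $\mathbf{HHGraph}$ is adhesive. (3) The functor $\mathbf{HHGraph}\to\mathbf{Set}$ sending a hierarchical hypergraph to its set of nodes has a left adjoint. -/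

import Mathlib

open CategoryTheory CategoryTheory.Limits

universe u

/-- A partial order is a tree order if every principal down-set `{x | x ≤ e}` is finite and
totally ordered. -/
class IsTreeOrder (E : Type u) [PartialOrder E] : Prop where
  finite_Iic : ∀ e : E, (Set.Iic e).Finite
  isChain_Iic : ∀ e : E, IsChain (· ≤ ·) (Set.Iic e)

theorem IsTreeOrder.exists_isGreatest {E : Type u} [PartialOrder E] [IsTreeOrder E] (e : E)
    (h : Set.Iic e ≠ {e}) : ∃ p, IsGreatest (Set.Iic e \ {e}) p := by
  have hne : (Set.Iic e \ {e}).Nonempty := by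
    by_contra hc
    rw [Set.not_nonempty_iff_eq_empty, Set.sdiff_eq_empty] at hc
    exact h (Set.Subset.antisymm hc (by simp))
  have hfin : (Set.Iic e \ {e}).Finite := (IsTreeOrder.finite_Iic e).subset Set.sdiff_subset
  obtain ⟨p, hp⟩ := hfin.exists_maximal hne
  refine ⟨p, hp.1, fun x hx => ?_⟩
  rcases (IsTreeOrder.isChain_Iic e).total hx.1 hp.1.1 with h1 | h1
  · exact h1
  · exact hp.2 hx h1

open Classical in
/-- The immediate predecessor function `E → E ⊔ {∗}`, with `none` in the role of `∗`: it sends `e`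
to the greatest element strictly below `e`, and to `∗` if `e` is minimal. -/
noncomputable def immPred {E : Type u} [PartialOrder E] [IsTreeOrder E] (e : E) : Option E :=
  if h : Set.Iic e ≠ {e} then some (IsTreeOrder.exists_isGreatest e h).choose else none

theorem immPred_eq_some_iff {E : Type u} [PartialOrder E] [IsTreeOrder E] (e p : E) :
    immPred e = some p ↔ IsGreatest (Set.Iic e \ {e}) p := by
  unfold immPred
  split_ifs with h
  · have hs := (IsTreeOrder.exists_isGreatest e h).choose_spec
    constructor
    · intro hp
      rw [← Option.some.inj hp]
      exact hs
    · intro hp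
      rw [hs.unique hp]
  · simp only [false_iff]
    intro hp
    rw [ne_eq, not_not] at h
    rw [h] at hp
    exact hp.1.2 hp.1.1

theorem immPred_eq_none_iff {E : Type u} [PartialOrder E] [IsTreeOrder E] (e : E) :
    immPred e = none ↔ Set.Iic e = {e} := by
  unfold immPred
  split_ifs with h
  · simpa using h
  · simpa using h

/-- A set equipped with a tree order: the objects of the category of trees. -/
structure TreeOrd : Type (u + 1) where
  carrier : Type u
  [order : PartialOrder carrier]
  [isTree : IsTreeOrder carrier]

namespace TreeOrd

attribute [instance] TreeOrd.order TreeOrd.isTree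

/-- Strict morphisms of tree orders: monotone maps `f` with `i_F ∘ f = f_∗ ∘ i_E`, where `i` is the
immediate predecessor function and `f_∗` extends `f` by `∗ ↦ ∗`. -/
@[ext]
structure Hom (E F : TreeOrd.{u}) : Type u where
  toFun : E.carrier → F.carrier
  monotone : Monotone toFun
  strict : ∀ e, immPred (toFun e) = (immPred e).map toFun

instance category : Category.{u} TreeOrd.{u} where
  Hom E F := Hom E F
  id E := ⟨fun e => e, monotone_id, fun e => by simp⟩
  comp f g := ⟨fun e => g.toFun (f.toFun e), g.monotone.comp f.monotone, fun e => by
    rw [g.strict, f.strict, Option.map_map]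
    rfl⟩

/-- The forgetful functor `|−| : Tree → Set`. -/
def forget : TreeOrd.{u} ⥤ Type u where
  obj E := E.carrier
  map f := ↾f.toFun

end TreeOrd

/-- The Kleene star `(−)^⋆ : Set → Set`, sending a set to the set of words in it. -/
def kleeneStar : Type u ⥤ Type u where
  obj V := List V
  map f := ↾(List.map f)

/-- A hierarchical hypergraph: a tree order of hyperedges, a set of nodes, and a word of nodes for
each hyperedge. -/
structure HHGraph : Type (u + 1) where
  edges : TreeOrd.{u}
  nodes : Type u
  ends : edges.carrier → List nodes

namespace HHGraph

/-- A morphism of hierarchical hypergraphs: a strict morphism `f` on hyperedges and a function `g`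
on nodes with `e_H ∘ |f| = g^⋆ ∘ e_G`. -/
@[ext]
structure Hom (G H : HHGraph.{u}) : Type u where
  onEdges : G.edges ⟶ H.edges
  onNodes : G.nodes → H.nodes
  comm : ∀ e, H.ends (onEdges.toFun e) = (G.ends e).map onNodes

instance category : Category.{u} HHGraph.{u} where
  Hom G H := Hom G H
  id G := ⟨𝟙 G.edges, fun v => v, fun e => (List.map_id _).symm⟩
  comp f g := ⟨f.onEdges ≫ g.onEdges, fun v => g.onNodes (f.onNodes v), fun e => by
    change _ = List.map (g.onNodes ∘ f.onNodes) _
    rw [← List.map_map, ← f.comm, ← g.comm]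
    rfl⟩

/-- The functor to sets sending a hierarchical hypergraph to its set of nodes. -/
def nodesFunctor : HHGraph.{u} ⥤ Type u where
  obj G := G.nodes
  map f := ↾f.onNodes

/-- The comparison functor from hierarchical hypergraphs to the comma category
`(|−| ↓ (−)^⋆)`. -/
def toComma : HHGraph.{u} ⥤ Comma TreeOrd.forget.{u} kleeneStar.{u} where
  obj G := { left := G.edges, right := G.nodes, hom := ↾G.ends }
  map f :=
    { left := f.onEdges
      right := ↾f.onNodes
      w := by ext e; exact f.comm e }

end HHGraph

/-! A tree order is the same thing as a well-founded coalgebra of `X ↦ Option X`, with structure map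
the immediate predecessor; strict maps are exactly the coalgebra morphisms, since monotonicity is
automatic (`monotone_of_immPred_comm`). So colimits of trees are computed on underlying sets, as are
nonempty limits preserved by `optionFunctor`, in particular pullbacks; well-foundedness survives in
both cases (`wellFounded_colimitPred`, `wellFounded_limitPred`). As `kleeneStar` preserves pullbacks
and `TreeOrd.forget` preserves pushouts, both are componentwise in the comma category. Hence
`edgesAndNodes` preserves them and reflects isomorphisms, and adhesivity is pulled back from a
category of set-valued functors. The left adjoint to nodes adds no hyperedges. -/

section ImmPred

variable {E F : Type u} [PartialOrder E] [IsTreeOrder E] [PartialOrder F] [IsTreeOrder F]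

theorem lt_of_immPred_eq_some {a b : E} (h : immPred b = some a) : a < b := by
  rw [immPred_eq_some_iff] at h
  exact lt_of_le_of_ne h.1.1 h.1.2

theorem exists_immPred_of_lt {x b : E} (h : x < b) : ∃ a, immPred b = some a ∧ x ≤ a := by
  have hx : x ∈ Set.Iic b \ {b} := ⟨h.le, h.ne⟩
  obtain ⟨a, ha⟩ := IsTreeOrder.exists_isGreatest b (fun hb => by rw [hb] at hx; exact hx.2 hx.1)
  exact ⟨a, (immPred_eq_some_iff b a).2 ha, ha.2 hx⟩

theorem wellFounded_immPred : WellFounded fun a b : E => immPred b = some a := by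
  have hlt : WellFounded ((· < ·) : E → E → Prop) := by
    refine ⟨fun b => ?_⟩
    have hwf : (Set.Iic b).WellFoundedOn (· < ·) := (IsTreeOrder.finite_Iic b).wellFoundedOn
    -- Accessibility of `b` only concerns elements joined to `b` by a `<`-chain, and these lie in
    -- the finite set `Set.Iic b`.
    refine (Set.WellFoundedOn.acc_iff_wellFoundedOn (r := ((· < ·) : E → E → Prop)) (a := b)).out
      0 1 |>.2 (hwf.subset ?_)
    intro x hx
    change Relation.ReflTransGen (· < ·) x b at hx
    induction hx using Relation.ReflTransGen.head_induction_on with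
    | refl => exact le_refl b
    | head h _ ih => exact h.le.trans ih
  exact Subrelation.wf (fun h => lt_of_immPred_eq_some h) hlt

/-- Maps commuting with immediate predecessors are monotone. -/
theorem monotone_of_immPred_comm {f : E → F}
    (hf : ∀ e, immPred (f e) = (immPred e).map f) : Monotone f := by
  intro x y
  induction y using (wellFounded_immPred (E := E)).induction with
  | _ y ih =>
    intro hxy
    rcases hxy.eq_or_lt with rfl | hlt
    · exact le_rfl
    · obtain ⟨a, ha, hxa⟩ := exists_immPred_of_lt hlt
      refine (ih a ha hxa).trans (lt_of_immPred_eq_some ?_).le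
      rw [hf, ha, Option.map_some]

end ImmPred

/-! ### Tree orders from well-founded predecessor functions -/

section OfPred

variable {E : Type u} {p : E → Option E} (wf : WellFounded fun a b => p b = some a)

/-- The order generated by a well-founded predecessor function. -/
abbrev partialOrderOfPred : PartialOrder E where
  le := Relation.ReflTransGen fun a b => p b = some a
  le_refl _ := .refl
  le_trans _ _ _ := .trans
  le_antisymm x y hxy hyx := by
    rcases Relation.reflTransGen_iff_eq_or_transGen.1 hxy with h | h
    · exact h.symm
    · exact ((wf.transGen.irrefl).irrefl x (h.trans_left hyx)).elim

/-- The down-set of `b` is that of its predecessor with `b` added on top, so both conditions follow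
by well-founded induction. -/
theorem isTreeOrder_ofPred :
    @IsTreeOrder E (partialOrderOfPred wf) := by
  let _ := partialOrderOfPred wf
  have le_iff : ∀ x b : E, x ≤ b ↔ x = b ∨ ∃ a, p b = some a ∧ x ≤ a := fun x b => by
    refine (Relation.ReflTransGen.cases_tail_iff _ x b).trans ?_
    exact or_congr eq_comm (exists_congr fun a => and_comm)
  refine ⟨fun b => ?_, fun b => ?_⟩
  · induction b using wf.induction with
    | _ b ih =>
      cases hb : p b with
      | none =>
        refine (Set.finite_singleton b).subset fun x hx => ?_
        rcases (le_iff x b).1 hx with h | ⟨a, ha, -⟩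
        · exact h
        · simp [hb] at ha
      | some a =>
        refine ((ih a hb).insert b).subset fun x hx => ?_
        rcases (le_iff x b).1 hx with h | ⟨a', ha, h⟩
        · exact Or.inl h
        · obtain rfl : a = a' := Option.some.inj (hb.symm.trans ha)
          exact Or.inr h
  · induction b using wf.induction with
    | _ b ih =>
      intro x hx y hy hne
      rcases (le_iff x b).1 hx with rfl | ⟨a, ha, hxa⟩
      · exact Or.inr hy
      rcases (le_iff y b).1 hy with rfl | ⟨a', ha', hya⟩
      · exact Or.inl hx
      obtain rfl : a = a' := Option.some.inj (ha.symm.trans ha')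
      exact ih a ha hxa hya hne

/-- The tree order generated by a well-founded predecessor function. -/
def TreeOrd.ofPred : TreeOrd.{u} :=
  @TreeOrd.mk E (partialOrderOfPred wf) (isTreeOrder_ofPred wf)

theorem TreeOrd.immPred_ofPred (e : (TreeOrd.ofPred wf).carrier) :
    immPred e = p e := by
  have le_of : ∀ {x b a : (TreeOrd.ofPred wf).carrier}, p b = some a → x < b → x ≤ a := by
    intro x b a ha hlt
    rcases (Relation.ReflTransGen.cases_tail_iff _ x b).1 hlt.le with h | ⟨a', h, ha'⟩
    · exact (hlt.ne' h).elim
    · obtain rfl : a = a' := Option.some.inj (ha.symm.trans ha')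
      exact h
  cases hp : p e with
  | none =>
    refine (immPred_eq_none_iff (E := (TreeOrd.ofPred wf).carrier) e).2 ?_
    refine Set.eq_singleton_iff_unique_mem.2 ⟨le_refl e, fun x hx => ?_⟩
    rcases (Relation.ReflTransGen.cases_tail_iff _ x e).1 hx with h | ⟨a, -, ha⟩
    · exact h.symm
    · rw [hp] at ha
      cases ha
  | some a =>
    refine (immPred_eq_some_iff (E := (TreeOrd.ofPred wf).carrier) e a).2 ?_
    have hle : (show (TreeOrd.ofPred wf).carrier from a) ≤ e := Relation.ReflTransGen.single hp
    refine ⟨⟨hle, fun h => ?_⟩, fun x hx => le_of hp (lt_of_le_of_ne hx.1 hx.2)⟩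
    obtain rfl : a = e := h
    exact wf.irrefl.irrefl a hp

end OfPred

/-! ### Preservation of pullbacks by `Option` and `List` -/

/-- The functor adjoining a base point, forgetting the base point. -/
def optionFunctor : Type u ⥤ Type u where
  obj X := Option X
  map f := ↾(Option.map f)
  map_id X := by
    apply ConcreteCategory.hom_ext
    exact fun x => congrFun Option.map_id x
  map_comp f g := by
    apply ConcreteCategory.hom_ext
    exact fun x => (Option.map_map g f x).symm

instance preservesPullbacks_optionFunctor :
    PreservesLimitsOfShape WalkingCospan optionFunctor.{u} := by
  refine preservesLimitsOfShape_walkingCospan_of_forall_isPullback fun X Y Z f g _ =>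
    ⟨_, _, _, IsPullback.of_hasPullback f g, ?_⟩
  have h := IsPullback.of_hasPullback f g
  rw [Types.isPullback_iff]
  refine ⟨by rw [← Functor.map_comp, h.w, Functor.map_comp], ?_, ?_⟩
  · intro (x : Option _) (y : Option _)
    rcases x with _ | x <;> rcases y with _ | y <;> rintro ⟨h₁, h₂⟩
    · rfl
    · cases h₁
    · cases h₁
    · exact congrArg some (Types.ext_of_isPullback h (Option.some.inj h₁) (Option.some.inj h₂))
  · intro (x : Option _) (y : Option _)
    rcases x with _ | x <;> rcases y with _ | y <;> intro hxy
    · exact ⟨none, rfl, rfl⟩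
    · cases hxy
    · cases hxy
    · obtain ⟨z, rfl, rfl⟩ := Types.exists_of_isPullback h x y (Option.some.inj hxy)
      exact ⟨some z, rfl, rfl⟩

/-- Words with equal images have equal length, so they can be matched letter by letter. -/
instance preservesPullbacks_kleeneStar :
    PreservesLimitsOfShape WalkingCospan kleeneStar.{u} := by
  refine preservesLimitsOfShape_walkingCospan_of_forall_isPullback fun X Y Z f g _ =>
    ⟨_, _, _, IsPullback.of_hasPullback f g, ?_⟩
  have h := IsPullback.of_hasPullback f g
  rw [Types.isPullback_iff]
  refine ⟨by rw [← Functor.map_comp, h.w, Functor.map_comp], ?_, ?_⟩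
  · intro (v : List _) (w : List _) hvw
    replace hvw : v.map (pullback.fst f g) = w.map (pullback.fst f g) ∧
      v.map (pullback.snd f g) = w.map (pullback.snd f g) := hvw
    induction v generalizing w with
    | nil => cases w with
      | nil => rfl
      | cons y w => simp at hvw
    | cons x v ih => cases w with
      | nil => simp at hvw
      | cons y w =>
        simp only [List.map_cons, List.cons.injEq] at hvw
        rw [Types.ext_of_isPullback h hvw.1.1 hvw.2.1, ih w ⟨hvw.1.2, hvw.2.2⟩]
  · intro (v : List X) (w : List Y) hvw
    replace hvw : v.map f = w.map g := hvw
    change ∃ z : List _, z.map (pullback.fst f g) = v ∧ z.map (pullback.snd f g) = w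
    induction v generalizing w with
    | nil => cases w with
      | nil => exact ⟨[], rfl, rfl⟩
      | cons y w => simp at hvw
    | cons x v ih => cases w with
      | nil => simp at hvw
      | cons y w =>
        simp only [List.map_cons, List.cons.injEq] at hvw
        obtain ⟨z, rfl, rfl⟩ := Types.exists_of_isPullback h x y hvw.1
        obtain ⟨zs, rfl, rfl⟩ := ih w hvw.2
        exact ⟨z :: zs, rfl, rfl⟩

/-! ### Trees as coalgebras, with their colimits and limits -/

namespace TreeOrd

/-- The immediate predecessor functions, as a natural transformation: this makes every tree order
a coalgebra for `optionFunctor`. -/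
noncomputable def predNat : forget.{u} ⟶ forget ⋙ optionFunctor where
  app E := ↾(immPred (E := E.carrier))
  naturality E F f := by
    apply ConcreteCategory.hom_ext
    exact f.strict

theorem hom_ext_forget {E F : TreeOrd.{u}} {f g : E ⟶ F} (h : forget.map f = forget.map g) :
    f = g :=
  Hom.ext (funext fun x => ConcreteCategory.congr_hom h x)

/-- A morphism of `optionFunctor`-coalgebras between tree orders is strict. -/
def homOfForget {E F : TreeOrd.{u}} (f : forget.obj E ⟶ forget.obj F)
    (h : f ≫ predNat.app F = predNat.app E ≫ optionFunctor.map f) : E ⟶ F :=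
  ⟨f, monotone_of_immPred_comm fun x => ConcreteCategory.congr_hom h x,
    fun x => ConcreteCategory.congr_hom h x⟩

theorem forget_map_homOfForget {E F : TreeOrd.{u}} (f : forget.obj E ⟶ forget.obj F)
    (h : f ≫ predNat.app F = predNat.app E ≫ optionFunctor.map f) :
    forget.map (homOfForget f h) = f := rfl

instance : forget.{u}.ReflectsIsomorphisms where
  reflects {E F} f _ := by
    refine ⟨homOfForget (inv (forget.map f)) ?_, ?_, ?_⟩
    · have h := predNat.naturality f
      dsimp only [Functor.comp_map] at h
      rw [IsIso.inv_comp_eq, ← Category.assoc, h, Category.assoc, ← Functor.map_comp,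
        IsIso.hom_inv_id, CategoryTheory.Functor.map_id, Category.comp_id]
    · apply hom_ext_forget
      rw [Functor.map_comp, forget_map_homOfForget, IsIso.hom_inv_id, CategoryTheory.Functor.map_id]
    · apply hom_ext_forget
      rw [Functor.map_comp, forget_map_homOfForget, IsIso.inv_hom_id, CategoryTheory.Functor.map_id]

/-- A well-founded `optionFunctor`-coalgebra, as a tree order. -/
def ofCoalgebra {X : Type u} (p : X ⟶ optionFunctor.obj X)
    (wf : WellFounded fun a b : X => p b = some a) : TreeOrd.{u} :=
  ofPred (p := p) wf

theorem predNat_app_ofCoalgebra {X : Type u} (p : X ⟶ optionFunctor.obj X)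
    (wf : WellFounded fun a b : X => p b = some a) : predNat.app (ofCoalgebra p wf) = p := by
  apply ConcreteCategory.hom_ext
  exact immPred_ofPred (p := p) wf

section Colimits

variable {J : Type*} [Category* J] {K : J ⥤ TreeOrd.{u}} {c : Cocone (K ⋙ forget)}
  (hc : IsColimit c)

/-- The predecessor function on a colimit of tree orders. -/
noncomputable def colimitPred : c.pt ⟶ optionFunctor.obj c.pt :=
  hc.desc ((Cocone.precompose (Functor.whiskerLeft K predNat :)).obj (optionFunctor.mapCocone c))

theorem ι_colimitPred (j : J) :
    c.ι.app j ≫ colimitPred hc = predNat.app (K.obj j) ≫ optionFunctor.map (c.ι.app j) :=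
  hc.fac _ j

/-- Every element comes from some `K.obj j`, and its predecessor comes from the same `K.obj j`, so
descent in the colimit lifts to descent in a single tree. -/
theorem wellFounded_colimitPred :
    WellFounded fun a b : c.pt => colimitPred hc b = some a := by
  refine ⟨fun x => ?_⟩
  obtain ⟨j, x, rfl⟩ := Types.jointly_surjective_of_isColimit hc x
  induction x using (wellFounded_immPred (E := (K.obj j).carrier)).induction with
  | _ x ih =>
    refine ⟨_, fun y hy => ?_⟩
    replace hy : (immPred (E := (K.obj j).carrier) x).map (c.ι.app j) = some y :=
      (ConcreteCategory.congr_hom (ι_colimitPred hc j) x).symm.trans hy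
    obtain ⟨z, hz, rfl⟩ := Option.map_eq_some_iff.1 hy
    exact ih z hz

/-- The cocone of tree orders on a colimit cocone of the underlying sets. -/
noncomputable def colimitCocone : Cocone K where
  pt := ofCoalgebra (colimitPred hc) (wellFounded_colimitPred hc)
  ι :=
    { app j := homOfForget (F := ofCoalgebra _ (wellFounded_colimitPred hc)) (c.ι.app j)
        (by rw [predNat_app_ofCoalgebra]; exact ι_colimitPred hc j)
      naturality i j f := hom_ext_forget (c.ι.naturality f) }

theorem desc_comp_predNat (s : Cocone K) :
    hc.desc (forget.mapCocone s) ≫ predNat.app s.pt =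
      colimitPred hc ≫ optionFunctor.map (hc.desc (forget.mapCocone s)) := by
  refine hc.hom_ext fun j => ?_
  have hd : c.ι.app j ≫ hc.desc (forget.mapCocone s) = forget.map (s.ι.app j) :=
    hc.fac (forget.mapCocone s) j
  rw [← Category.assoc, ← Category.assoc, ι_colimitPred, hd, Category.assoc,
    ← Functor.map_comp, hd]
  exact predNat.naturality (s.ι.app j)

/-- The colimit of tree orders is computed on underlying sets. -/
noncomputable def isColimitColimitCocone : IsColimit (colimitCocone hc) where
  desc s := homOfForget (E := ofCoalgebra _ (wellFounded_colimitPred hc))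
    (hc.desc (forget.mapCocone s)) (by
      rw [predNat_app_ofCoalgebra]
      exact desc_comp_predNat hc s)
  fac s j := hom_ext_forget (hc.fac (forget.mapCocone s) j)
  uniq s m hm := hom_ext_forget
    (hc.uniq (forget.mapCocone s) (forget.map m) fun j => congrArg forget.map (hm j))

end Colimits

instance hasColimitsOfShape {J : Type*} [Category* J] [HasColimitsOfShape J (Type u)] :
    HasColimitsOfShape J TreeOrd.{u} where
  has_colimit K := ⟨⟨_, isColimitColimitCocone (colimit.isColimit (K ⋙ forget))⟩⟩

instance preservesColimitsOfShape_forget {J : Type*} [Category* J]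
    [HasColimitsOfShape J (Type u)] : PreservesColimitsOfShape J forget.{u} where
  preservesColimit {K} := preservesColimit_of_preserves_colimit_cocone
    (isColimitColimitCocone (colimit.isColimit (K ⋙ forget)))
    (IsColimit.ofIsoColimit (colimit.isColimit (K ⋙ forget))
      (Cocone.ext (Iso.refl _) fun _ => Category.comp_id _))

section Limits

variable {J : Type*} [Category* J] {K : J ⥤ TreeOrd.{u}} {c : Cone (K ⋙ forget)}
  (hc : IsLimit c) [PreservesLimitsOfShape J optionFunctor.{u}]

/-- The predecessor function on a limit of tree orders. -/
noncomputable def limitPred : c.pt ⟶ optionFunctor.obj c.pt :=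
  (isLimitOfPreserves optionFunctor hc).lift
    ((Cone.postcompose (Functor.whiskerLeft K predNat :)).obj c)

theorem limitPred_π (j : J) :
    limitPred hc ≫ optionFunctor.map (c.π.app j) = c.π.app j ≫ predNat.app (K.obj j) :=
  (isLimitOfPreserves optionFunctor hc).fac _ j

theorem lift_comp_limitPred (s : Cone K) :
    hc.lift (forget.mapCone s) ≫ limitPred hc =
      predNat.app s.pt ≫ optionFunctor.map (hc.lift (forget.mapCone s)) := by
  refine (isLimitOfPreserves optionFunctor hc).hom_ext fun j => ?_
  have hd : hc.lift (forget.mapCone s) ≫ c.π.app j = forget.map (s.π.app j) :=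
    hc.fac (forget.mapCone s) j
  rw [Functor.mapCone_π_app, Category.assoc, Category.assoc, limitPred_π, ← Category.assoc, hd,
    ← Functor.map_comp, hd]
  exact predNat.naturality (s.π.app j)

/-- A single projection carries predecessor steps to predecessor steps in a tree; this is where `J`
must be nonempty. -/
theorem wellFounded_limitPred [Nonempty J] :
    WellFounded fun a b : c.pt => limitPred hc b = some a := by
  obtain ⟨j⟩ := ‹Nonempty J›
  refine Subrelation.wf (fun {a b} hab => ?_)
    (InvImage.wf (c.π.app j) (wellFounded_immPred (E := (K.obj j).carrier)))
  have h : (limitPred hc b).map (c.π.app j) = immPred (E := (K.obj j).carrier) (c.π.app j b) :=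
    ConcreteCategory.congr_hom (limitPred_π hc j) b
  rw [hab] at h
  exact h.symm

variable [Nonempty J]

/-- The cone of tree orders on a limit cone of the underlying sets. -/
noncomputable def limitCone : Cone K where
  pt := ofCoalgebra (limitPred hc) (wellFounded_limitPred hc)
  π :=
    { app j := homOfForget (E := ofCoalgebra _ (wellFounded_limitPred hc)) (c.π.app j)
        (by rw [predNat_app_ofCoalgebra]; exact (limitPred_π hc j).symm)
      naturality i j f := hom_ext_forget (c.π.naturality f) }

/-- Limits of tree orders preserved by `optionFunctor` are computed on underlying sets. -/
noncomputable def isLimitLimitCone : IsLimit (limitCone hc) where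
  lift s := homOfForget (F := ofCoalgebra _ (wellFounded_limitPred hc))
    (hc.lift (forget.mapCone s)) (by
      rw [predNat_app_ofCoalgebra]
      exact lift_comp_limitPred hc s)
  fac s j := hom_ext_forget (hc.fac (forget.mapCone s) j)
  uniq s m hm := hom_ext_forget
    (hc.uniq (forget.mapCone s) (forget.map m) fun j => congrArg forget.map (hm j))

end Limits

instance hasLimitsOfShape {J : Type*} [Category* J] [Nonempty J] [HasLimitsOfShape J (Type u)]
    [PreservesLimitsOfShape J optionFunctor.{u}] : HasLimitsOfShape J TreeOrd.{u} where
  has_limit K := ⟨⟨_, isLimitLimitCone (limit.isLimit (K ⋙ forget))⟩⟩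

instance preservesLimitsOfShape_forget {J : Type*} [Category* J] [Nonempty J]
    [HasLimitsOfShape J (Type u)] [PreservesLimitsOfShape J optionFunctor.{u}] :
    PreservesLimitsOfShape J forget.{u} where
  preservesLimit {K} := preservesLimit_of_preserves_limit_cone
    (isLimitLimitCone (limit.isLimit (K ⋙ forget)))
    (IsLimit.ofIsoLimit (limit.isLimit (K ⋙ forget))
      (Cone.ext (Iso.refl _) fun _ => (Category.id_comp _).symm))

end TreeOrd

/-! ### Projections from a comma category -/

section Comma

variable {A B T : Type*} [Category* A] [Category* B] [Category* T] (L : A ⥤ T) (R : B ⥤ T)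
  {J : Type*} [Category* J]

theorem preservesLimitsOfShape_commaFst [HasLimitsOfShape J A] [HasLimitsOfShape J B]
    [PreservesLimitsOfShape J R] : PreservesLimitsOfShape J (Comma.fst L R) where
  preservesLimit {F} := preservesLimit_of_preserves_limit_cone
    (Comma.coneOfPreservesIsLimit F (limit.isLimit _) (limit.isLimit _))
    (IsLimit.ofIsoLimit (limit.isLimit _)
      (Cone.ext (Iso.refl _) fun _ => (Category.id_comp _).symm))

theorem preservesLimitsOfShape_commaSnd [HasLimitsOfShape J A] [HasLimitsOfShape J B]
    [PreservesLimitsOfShape J R] : PreservesLimitsOfShape J (Comma.snd L R) where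
  preservesLimit {F} := preservesLimit_of_preserves_limit_cone
    (Comma.coneOfPreservesIsLimit F (limit.isLimit _) (limit.isLimit _))
    (IsLimit.ofIsoLimit (limit.isLimit _)
      (Cone.ext (Iso.refl _) fun _ => (Category.id_comp _).symm))

end Comma

/-! ### Transfer to hierarchical hypergraphs -/

namespace HHGraph

/-- The inverse of `toComma`. -/
def ofComma : Comma TreeOrd.forget.{u} kleeneStar.{u} ⥤ HHGraph.{u} where
  obj X := ⟨X.left, X.right, X.hom⟩
  map f := ⟨f.left, f.right, fun e => ConcreteCategory.congr_hom f.w e⟩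

/-- The isomorphism between hierarchical hypergraphs and the comma category, as an equivalence. -/
def commaEquivalence : HHGraph.{u} ≌ Comma TreeOrd.forget.{u} kleeneStar.{u} where
  functor := toComma
  inverse := ofComma
  unitIso := Iso.refl _
  counitIso := Iso.refl _

instance : toComma.{u}.IsEquivalence := commaEquivalence.isEquivalence_functor

/-- The hyperedges and the nodes of a hierarchical hypergraph, as a pair of sets. -/
def edgesAndNodes : HHGraph.{u} ⥤ Discrete WalkingPair ⥤ Type u :=
  (pair (toComma ⋙ Comma.fst _ _ ⋙ TreeOrd.forget) (toComma ⋙ Comma.snd _ _)).flip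

instance : HasPullbacks HHGraph.{u} :=
  Adjunction.hasLimitsOfShape_of_equivalence toComma

instance : HasPushouts HHGraph.{u} :=
  Adjunction.hasColimitsOfShape_of_equivalence toComma

instance : PreservesLimitsOfShape WalkingCospan edgesAndNodes.{u} := by
  have := preservesLimitsOfShape_commaFst (J := WalkingCospan) TreeOrd.forget.{u} kleeneStar.{u}
  have := preservesLimitsOfShape_commaSnd (J := WalkingCospan) TreeOrd.forget.{u} kleeneStar.{u}
  refine preservesLimitsOfShape_of_evaluation _ _ ?_
  rintro ⟨_ | _⟩
  · exact inferInstanceAs (PreservesLimitsOfShape WalkingCospan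
      (toComma ⋙ Comma.fst _ _ ⋙ TreeOrd.forget))
  · exact inferInstanceAs (PreservesLimitsOfShape WalkingCospan (toComma ⋙ Comma.snd _ _))

/-- Colimits in a comma category only require the left functor, here `TreeOrd.forget`, to preserve
them; nothing is asked of `kleeneStar`. -/
instance : PreservesColimitsOfShape WalkingSpan edgesAndNodes.{u} := by
  refine preservesColimitsOfShape_of_evaluation _ _ ?_
  rintro ⟨_ | _⟩
  · exact inferInstanceAs (PreservesColimitsOfShape WalkingSpan
      (toComma ⋙ Comma.fst _ _ ⋙ TreeOrd.forget))
  · exact inferInstanceAs (PreservesColimitsOfShape WalkingSpan (toComma ⋙ Comma.snd _ _))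

instance : edgesAndNodes.{u}.ReflectsIsomorphisms where
  reflects {G H} f _ := by
    have hl : IsIso (TreeOrd.forget.map (toComma.map f).left) :=
      inferInstanceAs (IsIso ((edgesAndNodes.map f).app ⟨.left⟩))
    have hr : IsIso (toComma.map f).right :=
      inferInstanceAs (IsIso ((edgesAndNodes.map f).app ⟨.right⟩))
    have := isIso_of_reflects_iso (toComma.map f).left TreeOrd.forget
    have : IsIso (toComma.map f) :=
      (Comma.isoMk (asIso (toComma.map f).left) (asIso (toComma.map f).right)
        (toComma.map f).w).isIso_hom
    exact isIso_of_reflects_iso f toComma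

/-- The empty tree order. -/
def emptyTree : TreeOrd.{u} :=
  TreeOrd.ofPred (E := PEmpty) (p := fun e => e.elim) ⟨fun e => e.elim⟩

instance : IsEmpty emptyTree.{u}.carrier := inferInstanceAs (IsEmpty PEmpty)

/-- Morphisms from a hypergraph without hyperedges are functions on nodes. -/
def edgelessEquiv (V : Type u) (H : HHGraph.{u}) :
    ((⟨emptyTree, V, isEmptyElim⟩ : HHGraph.{u}) ⟶ H) ≃ (V ⟶ nodesFunctor.obj H) where
  toFun f := nodesFunctor.map f
  invFun g := ⟨⟨isEmptyElim, fun e => isEmptyElim e, fun e => isEmptyElim e⟩, g,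
    fun e => isEmptyElim e⟩
  left_inv _ := Hom.ext (TreeOrd.Hom.ext (funext fun e => isEmptyElim e)) rfl
  right_inv _ := rfl

end HHGraph

theorem mainTheorem8 :
    (∃ K : Comma TreeOrd.forget.{u} kleeneStar.{u} ⥤ HHGraph.{u},
      HHGraph.toComma.{u} ⋙ K = 𝟭 _ ∧ K ⋙ HHGraph.toComma.{u} = 𝟭 _) ∧
    (HasPullbacks HHGraph.{u} ∧ Adhesive HHGraph.{u}) ∧
    HHGraph.nodesFunctor.{u}.IsRightAdjoint :=
  ⟨⟨HHGraph.ofComma, rfl, rfl⟩,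
    ⟨inferInstance, adhesive_of_preserves_and_reflects_isomorphism HHGraph.edgesAndNodes⟩,
    (Adjunction.adjunctionOfEquivLeft HHGraph.edgelessEquiv fun _ _ _ _ _ => rfl).isRightAdjoint⟩
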